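/- Let $d\mu(z)=\pi^{-1}e^{-|z|^2}\,dv(z)$ be the Gaussian measure on $\mathbb{C}$ ($dv$ is Lebesgue measure), let $F^2(\mathbb{C})$ be the space of entire functions in $L^2(\mathbb{C},d\mu)$, with inner product $\langle f,g\rangle=\int f\overline{g}\,d\mu$, and let $K_w(z)=e^{z\overline{w}}$ be the coherent states. For $\varphi:\mathbb{C}\to\mathbb{C}$ put $T_\varphi f(z)=\int\varphi(w)\,e^{z\overline{w}}f(w)\,d\mu(w)$ on $\mathrm{Dom}(T_\varphi)=\{f\in F^2(\mathbb{C}):\varphi f\in L^2(\mathbb{C},d\mu)\}$. We call $T_\varphi$ a Toeplitz operator if $K_w\in\mathrm{Dom}(T_\varphi)$ for all $w\in\mathbb{C}$, and a bounded Toeplitz operator if moreover $\|T_\varphi f\|\le C\|f\|$ for some constant $C$ and all $f\in\mathrm{Dom}(T_\varphi)$. Let $L_1^\infty(\mathbb{R}_+,e^{-r^2})$ be the space of measurable functions $\tau:\mathbb{R}_+\to\mathbb{C}$ with $\int_0^\infty|\tau(r)|e^{-r^2}r^n\,dr<\infty$ for all integers $n\ge 0$; such a $\tau$ is regarded as the radial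 symbol $z\mapsto\tau(|z|)$. Let $A$ be a linear operator in $F^2(\mathbb{C})$ (for instance a bounded operator on $F^2(\mathbb{C})$) whose domain contains all coherent states, let $\theta\in\mathbb{C}$, and suppose that the Wick symbol of $A$ is $e^{-\theta|z|^2}$, that is, $$\frac{\langle AK_z,K_z\rangle}{\langle K_z,K_z\rangle}=e^{-\theta|z|^2}\qquad\text{for all } z\in\mathbb{C}.$$ Write $A=T_\tau$ if $Af=T_\tau f$ for all $f\in\mathrm{Dom}(A)\cap\mathrm{Dom}(T_\tau)$. Then: 1. If $|\theta|^2=2\,\mathrm{Re}\,\theta$ and $\mathrm{Re}\,\theta>1$, there is no bounded Toeplitz operator $T_\tau$ such that $A=T_\tau$. 2. If $|\theta|^2>2\,\mathrm{Re}\,\theta$, there is no bounded Toeplitz operator $T_\tau$ with $\tau\in L_1^\infty(\mathbb{R}_+,e^{-r^2})$ such that $A=T_\tau$. -/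

import Mathlib

open MeasureTheory
open scoped ComplexConjugate NNReal

noncomputable section

namespace SegalBargmann

/-- The Gaussian measure `dμ(z) = π⁻¹ e^{-|z|²} dv(z)` on `ℂ`. -/
def gaussian : Measure ℂ :=
  (volume : Measure ℂ).withDensity
    (fun z => ENNReal.ofReal (Real.pi⁻¹ * Real.exp (-‖z‖ ^ 2)))

/-- The Segal-Bargmann space `F²(ℂ)`: the entire functions in `L²(ℂ, dμ)`. -/
def fockSpace : Submodule ℂ (ℂ → ℂ) where
  carrier := {f | Differentiable ℂ f ∧ MemLp f 2 gaussian}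
  add_mem' hf hg := ⟨hf.1.add hg.1, hf.2.add hg.2⟩
  zero_mem' := ⟨differentiable_const 0, MemLp.zero⟩
  smul_mem' c _ hf := ⟨hf.1.const_smul c, hf.2.const_smul c⟩

/-- The inner product of `L²(ℂ, dμ)`, linear in the first argument. -/
def fockInner (f g : ℂ → ℂ) : ℂ :=
  ∫ u, f u * conj (g u) ∂gaussian

/-- The reproducing kernel `K_w(z) = e^{z w̄}`. -/
def kernel (w z : ℂ) : ℂ :=
  Complex.exp (z * conj w)

theorem kernel_mem (w : ℂ) : kernel w ∈ fockSpace := by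
  have hd : Differentiable ℂ (kernel w) := by
    unfold kernel
    fun_prop
  refine ⟨hd, ?_⟩
  rw [memLp_two_iff_integrable_sq_norm hd.continuous.aestronglyMeasurable, gaussian,
    integrable_withDensity_iff (by fun_prop) (by simp)]
  have h := (GaussianFourier.integrable_cexp_neg_mul_sq_norm_add (V := ℂ) (b := 1)
    (by simp) 2 w).norm.mul_const (Real.pi⁻¹)
  refine h.congr (Filter.Eventually.of_forall fun u => ?_)
  have hin : (Inner.inner ℝ w u : ℝ) = (u * conj w).re := by
    simp [Complex.inner]
  have h0 : (0 : ℝ) ≤ Real.pi⁻¹ * Real.exp (-‖u‖ ^ 2) := by positivity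
  have h1 : ((-1 : ℂ) * (‖u‖ : ℂ) ^ 2 + 2 * ((Inner.inner ℝ w u : ℝ) : ℂ)).re
      = -‖u‖ ^ 2 + 2 * (u * conj w).re := by
    rw [hin]
    norm_cast
    simp
  simp only [kernel, Complex.norm_exp]
  rw [ENNReal.toReal_ofReal h0, h1, Real.exp_add, two_mul, Real.exp_add]
  ring

/-- The coherent state `K_w` as an element of `F²(ℂ)`. -/
def coherent (w : ℂ) : fockSpace :=
  ⟨kernel w, kernel_mem w⟩

/-- The Wick symbol `σ^W(A)(v̄, z) = ⟨A K_v, K_z⟩ / ⟨K_v, K_z⟩` of a linear operator `A` in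
`F²(ℂ)` whose domain contains the coherent states. -/
def wickSymbol (A : fockSpace →ₗ.[ℂ] fockSpace) (hA : ∀ w, coherent w ∈ A.domain) (v z : ℂ) : ℂ :=
  fockInner (A ⟨coherent v, hA v⟩ : fockSpace) (kernel z) / fockInner (kernel v) (kernel z)

/-- `Dom(T_φ)`: the `f ∈ F²(ℂ)` with `φ f ∈ L²(ℂ, dμ)`. -/
def toeplitzDomain (φ : ℂ → ℂ) : Set fockSpace :=
  {f | MemLp (fun w => φ w * (f : ℂ → ℂ) w) 2 gaussian}

/-- `T_φ f(z) = ∫ φ(w) e^{z w̄} f(w) dμ(w)`. -/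
def toeplitz (φ : ℂ → ℂ) (f : fockSpace) (z : ℂ) : ℂ :=
  ∫ w, φ w * Complex.exp (z * conj w) * (f : ℂ → ℂ) w ∂gaussian

/-- `T_φ` is a Toeplitz operator: its domain contains every coherent state. -/
def IsToeplitz (φ : ℂ → ℂ) : Prop :=
  ∀ w, coherent w ∈ toeplitzDomain φ

/-- `T_φ` is bounded on its domain, for the norm of `L²(ℂ, dμ)`. -/
def IsBoundedToeplitz (φ : ℂ → ℂ) : Prop :=
  IsToeplitz φ ∧ ∃ C : ℝ≥0, ∀ f ∈ toeplitzDomain φ,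
    eLpNorm (toeplitz φ f) 2 gaussian ≤ C * eLpNorm (f : ℂ → ℂ) 2 gaussian

/-- `A = T_φ`, that is, `A f = T_φ f` wherever both sides are defined. When `A` is defined on all
of `F²(ℂ)` this says that `A` extends `T_φ`. -/
def EqToeplitz (A : fockSpace →ₗ.[ℂ] fockSpace) (φ : ℂ → ℂ) : Prop :=
  ∀ f : A.domain, (f : fockSpace) ∈ toeplitzDomain φ →
    ((A f : fockSpace) : ℂ → ℂ) = toeplitz φ f

/-- The space `L₁^∞(ℝ₊, e^{-r²})`. -/
def MemL1Infty (a : ℝ → ℂ) : Prop :=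
  AEStronglyMeasurable a (volume.restrict (Set.Ioi 0)) ∧
    ∀ n : ℕ, IntegrableOn (fun r => ‖a r‖ * Real.exp (-r ^ 2) * r ^ n) (Set.Ioi 0)

end SegalBargmann

end

open MeasureTheory Filter
open scoped ComplexConjugate NNReal Topology

namespace SegalBargmann

/-! Suppose `A = T_τ`. The Wick symbol gives S(a,b) = ∫ τ(w) e^{a w̄ + b w} dμ(w) on the diagonal b
= ā. Since S is entire in each variable, polarization (`symbolTransform_eq_of_diagonal`) yields
S(a,b) = e^{(1-θ)ab} everywhere. Two tests follow. On b = -ā the exponential in the integral is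
unimodular, so S is bounded there by ∫ |τ| dμ, which forces Re θ ≤ 1. Moreover T_τ sends K_v to the
coherent state at conj(1-θ) v, so boundedness forces |1-θ| ≤ 1, that is |θ|² ≤ 2 Re θ. -/

/-! ### Gaussian integrals of exponentials. -/

theorem integral_gaussian (f : ℂ → ℂ) :
    ∫ u, f u ∂gaussian =
      (Real.pi : ℂ)⁻¹ * ∫ u : ℂ, Complex.exp (-(‖u‖ : ℂ) ^ 2) * f u := by
  rw [gaussian, integral_withDensity_eq_integral_toReal_smul (by fun_prop) (by simp),
    ← integral_const_mul]
  refine integral_congr_ae (Eventually.of_forall fun u => ?_)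
  have h0 : (0 : ℝ) ≤ Real.pi⁻¹ * Real.exp (-‖u‖ ^ 2) := by positivity
  simp only [ENNReal.toReal_ofReal h0, Complex.real_smul]
  push_cast
  ring

/-- The two-variable Gaussian moment generating function. -/
theorem integral_exp_gaussian (a b : ℂ) :
    ∫ u, Complex.exp (a * u + b * conj u) ∂gaussian = Complex.exp (a * b) := by
  rw [integral_gaussian,
    ← Complex.volume_preserving_equiv_real_prod.symm.integral_comp
      (MeasurableEquiv.measurableEmbedding _)]
  have key : ∀ p : ℝ × ℝ,
      Complex.exp (-(‖Complex.measurableEquivRealProd.symm p‖ : ℂ) ^ 2) *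
        Complex.exp (a * Complex.measurableEquivRealProd.symm p +
          b * conj (Complex.measurableEquivRealProd.symm p)) =
      Complex.exp ((-1) * (p.1 : ℂ) ^ 2 + (a + b) * p.1 + 0) *
        Complex.exp ((-1) * (p.2 : ℂ) ^ 2 + (Complex.I * (a - b)) * p.2 + 0) := by
    rintro ⟨x, y⟩
    rw [← Complex.exp_add, ← Complex.exp_add]
    congr 1
    have hz : Complex.measurableEquivRealProd.symm (x, y) = (x : ℂ) + y * Complex.I := by
      apply Complex.ext <;> simp
    rw [hz, ← Complex.mul_conj']
    simp only [map_add, map_mul, Complex.conj_ofReal, Complex.conj_I]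
    linear_combination (y : ℂ) ^ 2 * Complex.I_sq
  simp_rw [key]
  rw [Measure.volume_eq_prod, integral_prod_mul
    (fun x : ℝ => Complex.exp ((-1) * (x : ℂ) ^ 2 + (a + b) * x + 0))
    (fun y : ℝ => Complex.exp ((-1) * (y : ℂ) ^ 2 + (Complex.I * (a - b)) * y + 0)),
    integral_cexp_quadratic (by simp), integral_cexp_quadratic (by simp)]
  have hpi : (Real.pi : ℂ) ≠ 0 := by exact_mod_cast Real.pi_ne_zero
  have hs : ((Real.pi : ℂ) / -(-1)) ^ (1 / 2 : ℂ) * ((Real.pi : ℂ) / -(-1)) ^ (1 / 2 : ℂ)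
      = Real.pi := by
    rw [neg_neg, div_one, ← Complex.cpow_add _ _ hpi]
    norm_num
  have he : Complex.exp (0 - (a + b) ^ 2 / (4 * -1)) *
      Complex.exp (0 - (Complex.I * (a - b)) ^ 2 / (4 * -1)) = Complex.exp (a * b) := by
    rw [← Complex.exp_add]
    congr 1
    linear_combination (a - b) ^ 2 / 4 * Complex.I_sq
  calc _ = (Real.pi : ℂ)⁻¹ *
        ((((Real.pi : ℂ) / -(-1)) ^ (1 / 2 : ℂ) * ((Real.pi : ℂ) / -(-1)) ^ (1 / 2 : ℂ)) *
        (Complex.exp (0 - (a + b) ^ 2 / (4 * -1)) *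
          Complex.exp (0 - (Complex.I * (a - b)) ^ 2 / (4 * -1)))) := by ring
    _ = _ := by rw [hs, he, inv_mul_cancel_left₀ hpi]

theorem integrable_exp_gaussian (a b : ℂ) :
    Integrable (fun u => Complex.exp (a * u + b * conj u)) gaussian := by
  have h := (kernel_mem (conj a)).2.integrable_mul (kernel_mem b).2.star
  refine h.congr (Eventually.of_forall fun u => ?_)
  simp only [Pi.mul_apply, Pi.star_apply, kernel, Complex.conj_conj, RCLike.star_def,
    ← Complex.exp_conj, map_mul, ← Complex.exp_add]
  congr 1
  ring

instance : IsFiniteMeasure gaussian := by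
  have h := integrable_exp_gaussian 0 0
  simp only [zero_mul, add_zero, Complex.exp_zero] at h
  exact (integrable_const_iff_isFiniteMeasure one_ne_zero).1 h

theorem integral_norm_exp_gaussian (a b : ℂ) :
    ∫ u, ‖Complex.exp (a * u + b * conj u)‖ ∂gaussian = Real.exp (‖a + conj b‖ ^ 2 / 4) := by
  -- The modulus is e^{Re((a + b̄)u)} = e^{cu + c̄ū} with c = (a + b̄)/2, again an exponential of
  -- the same type.
  have h := integral_exp_gaussian ((a + conj b) / 2) (conj ((a + conj b) / 2))
  have hn : ∀ u : ℂ, Complex.exp ((a + conj b) / 2 * u + conj ((a + conj b) / 2) * conj u) =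
      ((‖Complex.exp (a * u + b * conj u)‖ : ℝ) : ℂ) := by
    intro u
    rw [Complex.norm_exp, Complex.ofReal_exp]
    congr 1
    rw [← map_mul, Complex.add_conj]
    norm_cast
    simp
    ring
  simp_rw [hn] at h
  rw [integral_complex_ofReal, Complex.mul_conj'] at h
  apply Complex.ofReal_injective
  rw [h]
  push_cast
  rw [norm_div]
  congr 1
  push_cast
  rw [Complex.norm_ofNat]
  push_cast
  ring

/-- The rate 1/3 lies below 1/2, as square integrability requires, and above 1/4, the rate that
arises in the Fubini argument of `fockInner_toeplitz_coherent`. -/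
theorem memLp_exp_sq_norm : MemLp (fun w : ℂ => Real.exp (‖w‖ ^ 2 / 3)) 2 gaussian := by
  have hc : Continuous fun w : ℂ => Real.exp (‖w‖ ^ 2 / 3) := by fun_prop
  rw [memLp_two_iff_integrable_sq_norm hc.aestronglyMeasurable, gaussian,
    integrable_withDensity_iff (by fun_prop) (by simp)]
  have h := (GaussianFourier.integrable_cexp_neg_mul_sq_norm_add (V := ℂ) (b := 1 / 3)
    (by norm_num) 0 0).norm.mul_const (Real.pi⁻¹)
  refine h.congr (Eventually.of_forall fun u => ?_)
  have h0 : (0 : ℝ) ≤ Real.pi⁻¹ * Real.exp (-‖u‖ ^ 2) := by positivity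
  have h1 : (-(1 / 3 : ℂ) * (‖u‖ : ℂ) ^ 2 + 0 * ((Inner.inner ℝ (0 : ℂ) u : ℝ) : ℂ)).re
      = ‖u‖ ^ 2 / 3 + ‖u‖ ^ 2 / 3 + -‖u‖ ^ 2 := by
    have : (-(1 / 3 : ℂ) * (‖u‖ : ℂ) ^ 2 + 0 * ((Inner.inner ℝ (0 : ℂ) u : ℝ) : ℂ))
      = ((-(1 / 3) * ‖u‖ ^ 2 : ℝ) : ℂ) := by push_cast; ring
    rw [this, Complex.ofReal_re]
    ring
  simp only [Complex.norm_exp]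
  rw [ENNReal.toReal_ofReal h0, h1, Real.exp_add, Real.exp_add, Real.norm_eq_abs,
    abs_of_pos (Real.exp_pos _)]
  ring

theorem integrable_mul_of_growth {τ g : ℂ → ℂ} (hτ : MemLp τ 2 gaussian)
    (hg : AEStronglyMeasurable g gaussian) (M : ℝ)
    (hM : ∀ w, ‖g w‖ ≤ M * Real.exp (‖w‖ ^ 2 / 3)) :
    Integrable (fun w => τ w * g w) gaussian :=
  hτ.integrable_mul (memLp_exp_sq_norm.of_le_mul hg (c := M) (Eventually.of_forall fun w => by
    simpa [abs_of_pos (Real.exp_pos _)] using hM w))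

theorem exp_mul_norm_le (c r : ℝ) : Real.exp (c * r) ≤ Real.exp (c ^ 2) * Real.exp (r ^ 2 / 3) := by
  rw [← Real.exp_add]
  apply Real.exp_le_exp.2
  nlinarith [sq_nonneg (c - r / 2), sq_nonneg r]

/-! ### Toeplitz operators on coherent states. -/

/-- The coherent state `K_0` is the constant 1. -/
theorem memLp_symbol {τ : ℂ → ℂ} (h : IsToeplitz τ) : MemLp τ 2 gaussian := by
  simpa [toeplitzDomain, coherent, kernel] using h 0

/-- The sesquianalytic kernel `∫ τ(w) e^{a w̄ + b w} dμ(w)` of a Toeplitz operator. -/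
noncomputable def symbolTransform (τ : ℂ → ℂ) (a b : ℂ) : ℂ :=
  ∫ w, τ w * Complex.exp (a * conj w + b * w) ∂gaussian

theorem toeplitz_coherent (τ : ℂ → ℂ) (v z : ℂ) :
    toeplitz τ (coherent v) z = symbolTransform τ z (conj v) := by
  refine integral_congr_ae (Eventually.of_forall fun w => ?_)
  simp only [coherent, kernel, mul_assoc, ← Complex.exp_add]
  ring_nf

/-- The reproducing property for the image of a coherent state. -/
theorem fockInner_toeplitz_coherent {τ : ℂ → ℂ} (hτ : MemLp τ 2 gaussian) (v z : ℂ) :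
    fockInner (toeplitz τ (coherent v)) (kernel z) = toeplitz τ (coherent v) z := by
  let F : ℂ → ℂ → ℂ := fun u w =>
    (τ w * Complex.exp (conj v * w)) * Complex.exp (conj w * u + z * conj u)
  have hm : AEStronglyMeasurable (Function.uncurry F) (gaussian.prod gaussian) := by
    have h1 : AEStronglyMeasurable (fun p : ℂ × ℂ => τ p.2) (gaussian.prod gaussian) :=
      hτ.1.comp_snd
    have h2 : Continuous fun p : ℂ × ℂ => Complex.exp (conj v * p.2) := by fun_prop
    have h3 : Continuous fun p : ℂ × ℂ => Complex.exp (conj p.2 * p.1 + z * conj p.1) := by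
      fun_prop
    exact (h1.mul h2.aestronglyMeasurable).mul h3.aestronglyMeasurable
  have hF : Integrable (Function.uncurry F) (gaussian.prod gaussian) := by
    rw [integrable_prod_iff' hm]
    refine ⟨Eventually.of_forall fun w => ?_, ?_⟩
    · exact (integrable_exp_gaussian (conj w) z).const_mul (τ w * Complex.exp (conj v * w))
    have hn : ∀ w, ∫ u, ‖Function.uncurry F (u, w)‖ ∂gaussian =
        ‖τ w * (Complex.exp (conj v * w) *
          ((Real.exp (‖conj w + conj z‖ ^ 2 / 4) : ℝ) : ℂ))‖ := by
      intro w
      simp only [Function.uncurry, F, norm_mul]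
      rw [integral_const_mul, integral_norm_exp_gaussian, Complex.norm_real, Real.norm_eq_abs,
        abs_of_pos (Real.exp_pos _)]
      ring
    simp_rw [hn]
    refine (integrable_mul_of_growth hτ ?_
      -- With s = |z|/2 + |v|, the constant is the maximum over |w| of s|w| - |w|²/12 + |z|²/4,
      -- attained at |w| = 6s; here -1/12 = 1/4 - 1/3.
      (Real.exp (3 * (‖z‖ / 2 + ‖v‖) ^ 2 + ‖z‖ ^ 2 / 4)) fun w => ?_).norm
    · exact Continuous.aestronglyMeasurable (by fun_prop)
    · rw [norm_mul, Complex.norm_real, Real.norm_eq_abs, abs_of_pos (Real.exp_pos _),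
        Complex.norm_exp, ← Real.exp_add, ← Real.exp_add]
      apply Real.exp_le_exp.2
      have h1 : (conj v * w).re ≤ ‖v‖ * ‖w‖ := by
        simpa using Complex.re_le_norm (conj v * w)
      have h2 : ‖conj w + conj z‖ ≤ ‖w‖ + ‖z‖ := by
        simpa using norm_add_le (conj w) (conj z)
      have h3 : ‖conj w + conj z‖ ^ 2 ≤ (‖w‖ + ‖z‖) ^ 2 := by gcongr
      nlinarith [sq_nonneg (‖w‖ - 6 * (‖z‖ / 2 + ‖v‖))]
  calc fockInner (toeplitz τ (coherent v)) (kernel z)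
      = ∫ u, ∫ w, F u w ∂gaussian ∂gaussian := by
        refine integral_congr_ae (Eventually.of_forall fun u => ?_)
        simp only [toeplitz, ← integral_mul_const]
        refine integral_congr_ae (Eventually.of_forall fun w => ?_)
        simp only [coherent, kernel, F, ← Complex.exp_conj, map_mul, Complex.conj_conj,
          mul_assoc, ← Complex.exp_add]
        ring_nf
    _ = ∫ w, ∫ u, F u w ∂gaussian ∂gaussian := integral_integral_swap hF
    _ = toeplitz τ (coherent v) z := by
        refine integral_congr_ae (Eventually.of_forall fun w => ?_)
        simp only [F]
        rw [integral_const_mul, integral_exp_gaussian]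
        simp only [coherent, kernel, mul_assoc, ← Complex.exp_add]
        ring_nf

theorem fockInner_kernel (v z : ℂ) :
    fockInner (kernel v) (kernel z) = Complex.exp (z * conj v) := by
  rw [mul_comm, ← integral_exp_gaussian]
  refine integral_congr_ae (Eventually.of_forall fun u => ?_)
  simp only [kernel, ← Complex.exp_conj, map_mul, Complex.conj_conj, ← Complex.exp_add]
  ring_nf

theorem eLpNorm_kernel (v : ℂ) :
    eLpNorm (kernel v) 2 gaussian = ENNReal.ofReal (Real.exp (‖v‖ ^ 2 / 2)) := by
  rw [(kernel_mem v).2.eLpNorm_eq_integral_rpow_norm (by norm_num) (by norm_num)]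
  congr 1
  have h : ∫ u, ‖kernel v u‖ ^ (2 : ℝ) ∂gaussian = Real.exp (‖v‖ ^ 2) := by
    have hk := integral_norm_exp_gaussian (2 * conj v) 0
    have hn : ∀ u, ‖kernel v u‖ ^ (2 : ℝ) = ‖Complex.exp (2 * conj v * u + 0 * conj u)‖ := by
      intro u
      rw [Real.rpow_ofNat, ← norm_pow, kernel, ← Complex.exp_nat_mul]
      congr 2
      push_cast
      ring
    simp_rw [hn, hk]
    simp
    ring
  simp only [ENNReal.toReal_ofNat, h]
  rw [← Real.exp_mul]
  ring_nf

/-! ### Analyticity and polarization. -/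

/-- A dominated exponential transform is entire. -/
theorem differentiable_integral_mul_exp {τ q p : ℂ → ℂ} (hτ : MemLp τ 2 gaussian)
    (hq : Continuous q) (hp : Continuous p) {A B : ℝ} (hA : ∀ w, ‖q w‖ ≤ A * ‖w‖)
    (hB : ∀ w, ‖p w‖ ≤ B * ‖w‖) :
    Differentiable ℂ fun x => ∫ w, τ w * Complex.exp (q w + x * p w) ∂gaussian := by
  intro x₀
  have hbound : ∀ x w : ℂ, ‖x‖ ≤ ‖x₀‖ + 1 →
      ‖Complex.exp (q w + x * p w)‖ ≤ Real.exp ((A + (‖x₀‖ + 1) * B) * ‖w‖) := by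
    intro x w hx
    rw [Complex.norm_exp]
    apply Real.exp_le_exp.2
    have h1 : (q w + x * p w).re ≤ ‖q w‖ + ‖x‖ * ‖p w‖ :=
      (Complex.re_le_norm _).trans ((norm_add_le _ _).trans_eq (by rw [norm_mul]))
    have h2 : ‖x‖ * ‖p w‖ ≤ (‖x₀‖ + 1) * (B * ‖w‖) := by
      gcongr
      exact hB w
    nlinarith [hA w]
  have hbound' : ∀ x w : ℂ, ‖x‖ ≤ ‖x₀‖ + 1 →
      ‖p w * Complex.exp (q w + x * p w)‖ ≤ Real.exp ((A + (‖x₀‖ + 2) * B) * ‖w‖) := by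
    intro x w hx
    -- Absorbing the factor `p w` into an exponential costs one more `B` in the rate.
    have h1 : ‖p w‖ ≤ Real.exp (B * ‖w‖) := by
      linarith [hB w, Real.add_one_le_exp (B * ‖w‖)]
    calc _ ≤ Real.exp (B * ‖w‖) * Real.exp ((A + (‖x₀‖ + 1) * B) * ‖w‖) := by
          rw [norm_mul]
          gcongr
          exact hbound x w hx
      _ = _ := by rw [← Real.exp_add]; ring_nf
  have hx₀ : ‖x₀‖ ≤ ‖x₀‖ + 1 := by linarith
  have hE : ∀ c : ℝ, Integrable (fun w => ‖τ w‖ * Real.exp (c * ‖w‖)) gaussian := by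
    intro c
    have h := (integrable_mul_of_growth (g := fun w => ((Real.exp (c * ‖w‖) : ℝ) : ℂ)) hτ
      (Continuous.aestronglyMeasurable (by fun_prop)) (Real.exp (c ^ 2)) fun w => by
        rw [Complex.norm_real, Real.norm_eq_abs, abs_of_pos (Real.exp_pos _)]
        exact exp_mul_norm_le c ‖w‖).norm
    refine h.congr (Eventually.of_forall fun w => ?_)
    simp only [norm_mul]
    rw [Complex.norm_real, Real.norm_eq_abs, abs_of_pos (Real.exp_pos _)]
  have hmeas : ∀ x, AEStronglyMeasurable (fun w => τ w * Complex.exp (q w + x * p w)) gaussian :=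
    fun x => hτ.1.mul (Continuous.aestronglyMeasurable (by fun_prop))
  refine (hasDerivAt_integral_of_dominated_loc_of_deriv_le (Metric.ball_mem_nhds x₀ one_pos)
    (F' := fun x w => τ w * (p w * Complex.exp (q w + x * p w)))
    (bound := fun w => ‖τ w‖ * Real.exp ((A + (‖x₀‖ + 2) * B) * ‖w‖))
    (Eventually.of_forall hmeas) ?_ ?_ ?_ (hE _) ?_).2.differentiableAt
  · refine (hE (A + (‖x₀‖ + 1) * B)).mono' (hmeas x₀) (Eventually.of_forall fun w => ?_)
    rw [norm_mul]
    gcongr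
    exact hbound x₀ w hx₀
  · exact hτ.1.mul (Continuous.aestronglyMeasurable (by fun_prop))
  · refine Eventually.of_forall fun w x hx => ?_
    have hx' : ‖x‖ ≤ ‖x₀‖ + 1 := by
      have := norm_sub_norm_le x x₀
      rw [Metric.mem_ball, dist_eq_norm] at hx
      linarith
    rw [norm_mul]
    gcongr
    exact hbound' x w hx'
  · refine Eventually.of_forall fun w x _ => ?_
    have h1 : HasDerivAt (fun x : ℂ => q w + x * p w) (p w) x := by
      simpa using ((hasDerivAt_id x).mul_const (p w)).const_add (q w)
    simpa [mul_comm, mul_assoc, mul_left_comm] using (h1.cexp.const_mul (τ w))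

theorem eq_of_eq_on_real {f g : ℂ → ℂ} (hf : Differentiable ℂ f) (hg : Differentiable ℂ g)
    (h : ∀ x : ℝ, f x = g x) : f = g := by
  refine AnalyticOnNhd.eq_of_frequently_eq (z₀ := 0)
    (fun z _ => hf.analyticAt z) (fun z _ => hg.analyticAt z) ?_
  have ht : Tendsto (fun n : ℕ => ((1 / ((n : ℝ) + 1) : ℝ) : ℂ)) atTop (𝓝[≠] 0) := by
    refine tendsto_nhdsWithin_iff.2 ⟨?_, Eventually.of_forall fun n => ?_⟩
    · exact_mod_cast (Complex.continuous_ofReal.tendsto 0).comp tendsto_one_div_add_atTop_nhds_zero_nat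
    · simp only [Set.mem_compl_iff, Set.mem_singleton_iff, Complex.ofReal_eq_zero]
      positivity
  exact ht.frequently (Eventually.of_forall fun n => h _).frequently

/-- Polarization: the diagonal values determine the transform. -/
theorem symbolTransform_eq_of_diagonal {τ : ℂ → ℂ} (hτ : MemLp τ 2 gaussian) (c : ℂ)
    (h : ∀ z, symbolTransform τ z (conj z) = Complex.exp (c * (z * conj z))) (a b : ℂ) :
    symbolTransform τ a b = Complex.exp (c * (a * b)) := by
  -- In the coordinates a = x + iy, b = x - iy, the diagonal b = ā is the real plane, and the
  -- identity theorem frees x and y one at a time.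
  let G : ℂ → ℂ → ℂ := fun x y => symbolTransform τ (x + Complex.I * y) (x - Complex.I * y)
  let E : ℂ → ℂ → ℂ := fun x y =>
    Complex.exp (c * ((x + Complex.I * y) * (x - Complex.I * y)))
  have hp : ∀ w : ℂ, ‖conj w + w‖ ≤ 2 * ‖w‖ := fun w => by
    linarith [norm_add_le (conj w) w, Complex.norm_conj w]
  have hm : ∀ w : ℂ, ‖Complex.I * (conj w - w)‖ ≤ 2 * ‖w‖ := fun w => by
    rw [norm_mul, Complex.norm_I, one_mul]
    linarith [norm_sub_le (conj w) w, Complex.norm_conj w]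
  have hscale : ∀ (x : ℂ) {r : ℂ → ℂ}, (∀ w, ‖r w‖ ≤ 2 * ‖w‖) →
      ∀ w, ‖x * r w‖ ≤ (‖x‖ * 2) * ‖w‖ := fun x r hr w => by
    rw [norm_mul, mul_assoc]
    exact mul_le_mul_of_nonneg_left (hr w) (norm_nonneg x)
  have hGx : ∀ y, Differentiable ℂ fun x => G x y := fun y => by
    convert differentiable_integral_mul_exp hτ
      (q := fun w => y * (Complex.I * (conj w - w))) (p := fun w => conj w + w)
      (by fun_prop) (by fun_prop) (hscale y hm) hp using 2 with x
    refine integral_congr_ae (Eventually.of_forall fun w => ?_)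
    simp only
    ring_nf
  have hGy : ∀ x, Differentiable ℂ fun y => G x y := fun x => by
    convert differentiable_integral_mul_exp hτ
      (q := fun w => x * (conj w + w)) (p := fun w => Complex.I * (conj w - w))
      (by fun_prop) (by fun_prop) (hscale x hp) hm using 2 with y
    refine integral_congr_ae (Eventually.of_forall fun w => ?_)
    simp only
    ring_nf
  have hreal : ∀ x y : ℝ, G x y = E x y := fun x y => by
    have hz := h (x + Complex.I * y)
    simpa [G, E, sub_eq_add_neg] using hz
  have hmix : ∀ (y : ℝ) (x : ℂ), G x y = E x y := fun y x =>
    congrFun (eq_of_eq_on_real (g := fun x => E x y) (hGx y) (by fun_prop) fun x => hreal x y) x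
  have hall : ∀ x y : ℂ, G x y = E x y := fun x y =>
    congrFun (eq_of_eq_on_real (g := fun y => E x y) (hGy x) (by fun_prop) fun y => hmix y x) y
  have hab := hall ((a + b) / 2) (-Complex.I * (a - b) / 2)
  have e1 : (a + b) / 2 + Complex.I * (-Complex.I * (a - b) / 2) = a := by
    linear_combination (-(a - b) / 2) * Complex.I_sq
  have e2 : (a + b) / 2 - Complex.I * (-Complex.I * (a - b) / 2) = b := by
    linear_combination ((a - b) / 2) * Complex.I_sq
  simpa only [G, E, e1, e2] using hab

/-- A Toeplitz operator with Gaussian Wick symbol has a Gaussian kernel. -/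
theorem symbolTransform_of_wickSymbol {A : fockSpace →ₗ.[ℂ] fockSpace}
    {hA : ∀ w, coherent w ∈ A.domain} {θ : ℂ}
    (hW : ∀ z : ℂ, wickSymbol A hA z z = Complex.exp (-θ * (‖z‖ : ℂ) ^ 2))
    {τ : ℂ → ℂ} (hτ : IsToeplitz τ) (hAτ : EqToeplitz A τ) (a b : ℂ) :
    symbolTransform τ a b = Complex.exp ((1 - θ) * (a * b)) := by
  refine symbolTransform_eq_of_diagonal (memLp_symbol hτ) _ (fun z => ?_) a b
  have h := hW z
  -- The denominator ⟨K_z, K_z⟩ = e^{|z|²} turns -θ into 1 - θ.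
  rw [wickSymbol, hAτ ⟨coherent z, hA z⟩ (hτ z), fockInner_toeplitz_coherent (memLp_symbol hτ),
    fockInner_kernel, toeplitz_coherent, div_eq_iff (Complex.exp_ne_zero _),
    ← Complex.exp_add] at h
  rw [h, Complex.mul_conj']
  congr 1
  ring

/-! ### The two growth tests. -/

theorem not_forall_exp_le {c : ℝ} (hc : 0 < c) (M : ℝ) :
    ¬ ∀ r : ℝ, Real.exp (c * r ^ 2) ≤ M := by
  intro h
  have h1 := h (|M| / c + 1)
  have h2 := Real.add_one_le_exp (c * (|M| / c + 1) ^ 2)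
  have h3 : c * (|M| / c + 1) ^ 2 = |M| * (|M| / c) + 2 * |M| + c := by
    field_simp
    ring
  have h4 : 0 ≤ |M| * (|M| / c) := by positivity
  linarith [le_abs_self M, abs_nonneg M]

/-- On the antidiagonal the transform is a Fourier transform, hence bounded. -/
theorem norm_symbolTransform_neg_conj_le (τ : ℂ → ℂ) (z : ℂ) :
    ‖symbolTransform τ z (-conj z)‖ ≤ ∫ w, ‖τ w‖ ∂gaussian := by
  refine (norm_integral_le_integral_norm _).trans_eq
    (integral_congr_ae (Eventually.of_forall fun w => ?_))
  have : (z * conj w + -conj z * w).re = 0 := by simp [mul_comm]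
  simp only [norm_mul, Complex.norm_exp, this, Real.exp_zero, mul_one]

/-- At (r, -r) with r real, the Gaussian has modulus e^{(Re θ - 1) r²}, which must stay bounded. -/
theorem re_le_one_of_symbolTransform {τ : ℂ → ℂ} {θ : ℂ}
    (h : ∀ a b, symbolTransform τ a b = Complex.exp ((1 - θ) * (a * b))) : θ.re ≤ 1 := by
  by_contra! hθ
  refine not_forall_exp_le (sub_pos.2 hθ) (∫ w, ‖τ w‖ ∂gaussian) fun r => ?_
  have hr := norm_symbolTransform_neg_conj_le τ r
  rw [h, Complex.norm_exp] at hr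
  convert hr using 2
  rw [Complex.conj_ofReal, show (1 - θ) * ((r : ℂ) * -r) = ((r ^ 2 : ℝ) : ℂ) * (θ - 1) by
    push_cast; ring, Complex.re_ofReal_mul]
  simp
  ring

/-- As ‖K_v‖ = e^{|v|²/2}, the ratio ‖T_τ K_r‖ / ‖K_r‖ is e^{(|1-θ|² - 1) r²/2}, which must stay
bounded. -/
theorem norm_one_sub_le_one_of_isBoundedToeplitz {τ : ℂ → ℂ} {θ : ℂ} (hτ : IsBoundedToeplitz τ)
    (h : ∀ a b, symbolTransform τ a b = Complex.exp ((1 - θ) * (a * b))) : ‖1 - θ‖ ≤ 1 := by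
  obtain ⟨hT, C, hC⟩ := hτ
  by_contra! hθ
  have hpos : 0 < (‖1 - θ‖ ^ 2 - 1) / 2 := by nlinarith
  refine not_forall_exp_le hpos C fun r => ?_
  have hr := hC _ (hT r)
  have hk : toeplitz τ (coherent r) = kernel (conj (1 - θ) * r) := by
    funext z
    rw [toeplitz_coherent, h, kernel]
    simp only [map_mul, Complex.conj_conj]
    ring_nf
  rw [hk, show ((coherent r : fockSpace) : ℂ → ℂ) = kernel r from rfl, eLpNorm_kernel,
    eLpNorm_kernel, ← ENNReal.ofReal_coe_nnreal, ← ENNReal.ofReal_mul C.coe_nonneg,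
    ENNReal.ofReal_le_ofReal_iff (by positivity), ← div_le_iff₀ (Real.exp_pos _),
    ← Real.exp_sub] at hr
  refine le_of_eq_of_le (congrArg Real.exp ?_) hr
  rw [norm_mul, Complex.norm_conj, Complex.norm_real, mul_pow, Real.norm_eq_abs, sq_abs]
  ring

end SegalBargmann

theorem mainTheorem2 (A : SegalBargmann.fockSpace →ₗ.[ℂ] SegalBargmann.fockSpace)
    (hA : ∀ w, SegalBargmann.coherent w ∈ A.domain) (θ : ℂ)
    (hW : ∀ z : ℂ, SegalBargmann.wickSymbol A hA z z = Complex.exp (-θ * (‖z‖ : ℂ) ^ 2)) :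
    (‖θ‖ ^ 2 = 2 * θ.re → 1 < θ.re →
      ¬ ∃ τ : ℂ → ℂ, SegalBargmann.IsBoundedToeplitz τ ∧ SegalBargmann.EqToeplitz A τ) ∧
    (2 * θ.re < ‖θ‖ ^ 2 →
      ¬ ∃ τ : ℝ → ℂ, SegalBargmann.MemL1Infty τ ∧
        SegalBargmann.IsBoundedToeplitz (fun z => τ ‖z‖) ∧
        SegalBargmann.EqToeplitz A (fun z => τ ‖z‖)) := by
  constructor
  · rintro - hθ ⟨τ, hτ, hAτ⟩
    exact hθ.not_ge (SegalBargmann.re_le_one_of_symbolTransform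
      (SegalBargmann.symbolTransform_of_wickSymbol hW hτ.1 hAτ))
  · rintro hθ ⟨τ, -, hτ, hAτ⟩
    have h := SegalBargmann.norm_one_sub_le_one_of_isBoundedToeplitz hτ
      (SegalBargmann.symbolTransform_of_wickSymbol hW hτ.1 hAτ)
    have h2 : ‖1 - θ‖ ^ 2 ≤ 1 := pow_le_one₀ (norm_nonneg _) h
    have h3 : ‖1 - θ‖ ^ 2 = 1 - 2 * θ.re + ‖θ‖ ^ 2 := by
      rw [← Complex.normSq_eq_norm_sq, ← Complex.normSq_eq_norm_sq, Complex.normSq_apply,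
        Complex.normSq_apply]
      simp
      ring
    linarith
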